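/- Let $(W_n)_n$ be a sequence of finite Coxeter groups, each with a fixed set $S_n$ of simple reflections, such that for each $n$ every irreducible component of $W_n$ is of dihedral type (i.e. of rank $2$). Write $$W_n=\prod_{i=1}^{k_n} \mathrm{I}_2(m_{n,i}),\qquad m_{n,i}\ge 3,$$ where $S_n$ is the union of the sets of simple reflections of the factors, and $\mathrm{I}_2(m)=\langle a,b \mid a^2=b^2=(ab)^m=1\rangle$ has simple reflections $a,b$. For $w\in W_n$ let $\ell(w)$ be the word length with respect to $S_n$, let $\operatorname{des}(w)=|\{s\in S_n : \ell(ws)<\ell(w)\}|$ and $t(w)=\operatorname{des}(w)+\operatorname{des}(w^{-1})$, and let $T_n$ be the random variable $t(w)$ for $w$ chosen uniformly at random from $W_n$. If $$\sum_{i=1}^{k_n}\frac{1}{m_{n,i}}\longrightarrow\infty\quad (n\to\infty),$$ then $(T_n)_n$ satisfies the central limit theorem, that is, $$\frac{T_n-\mathbb{E}(T_n)}{\sqrt{\mathbb{V}(T_n)}}\stackrel{D}{\longrightarrow}N(0,1).$$ -/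

import Mathlib

open Filter MeasureTheory ProbabilityTheory

noncomputable section

namespace CoxeterSystem

variable {B W : Type*} [Group W] {M : CoxeterMatrix B}

/-- The set `S ⊆ W` of simple reflections of a Coxeter system. -/
def simpleReflections (cs : CoxeterSystem M W) : Set W :=
  Set.range cs.simple

/-- The descent set `Des(w) = {s ∈ S | ℓ(ws) < ℓ(w)}`. -/
def descentSet (cs : CoxeterSystem M W) (w : W) : Set W :=
  {s | s ∈ cs.simpleReflections ∧ cs.length (w * s) < cs.length w}

/-- The number of descents `des(w) = |Des(w)|`. -/
def des (cs : CoxeterSystem M W) (w : W) : ℕ :=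
  (cs.descentSet w).ncard

/-- The statistic `t(w) = des(w) + des(w⁻¹)`. -/
def tStat (cs : CoxeterSystem M W) (w : W) : ℕ :=
  cs.des w + cs.des w⁻¹

/-- The Coxeter system `(W, S)` is the product of the Coxeter systems `(W' i, S' i)`: the group `W`
is identified with the direct product of the groups `W' i` in such a way that `S` becomes the union
of the sets `S' i`, each `W' i` being regarded as a subgroup of the product. -/
def IsProduct {ι : Type*} [DecidableEq ι] {B' W' : ι → Type*} [∀ i, Group (W' i)]
    {M' : ∀ i, CoxeterMatrix (B' i)} (cs : CoxeterSystem M W)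
    (cs' : ∀ i, CoxeterSystem (M' i) (W' i)) : Prop :=
  ∃ φ : W ≃* (∀ i, W' i),
    φ '' cs.simpleReflections = ⋃ i, Pi.mulSingle i '' (cs' i).simpleReflections

end CoxeterSystem

/-- The Coxeter matrix of type `I₂(m)` for `m ≥ 2`: rank two with off-diagonal entry `m`
(Mathlib's `CoxeterMatrix.I k` has off-diagonal entry `k + 2`). -/
def dihedralMatrix (m : ℕ) : CoxeterMatrix (Fin 2) :=
  CoxeterMatrix.I (m - 2)

theorem dihedralMatrix_apply {m : ℕ} (hm : 2 ≤ m) (a b : Fin 2) :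
    dihedralMatrix m a b = if a = b then 1 else m := by
  have h : m - 2 + 2 = m := by omega
  simp [dihedralMatrix, CoxeterMatrix.I, h]

/-- The Coxeter system of type `I₂(m)`, for `m ≥ 2`. -/
def dihedralSystem (m : ℕ) : CoxeterSystem (dihedralMatrix m) (dihedralMatrix m).Group :=
  (dihedralMatrix m).toCoxeterSystem

/-- A sequence of real random variables `X n` (each on its own probability space) satisfies the
central limit theorem: every `X n` is square-integrable, and `(X n - 𝔼(X n)) / √(𝕍(X n))`
converges in distribution to the standard Gaussian. -/
def SatisfiesCLT {Ω : ℕ → Type*} [∀ n, MeasurableSpace (Ω n)] (X : ∀ n, Ω n → ℝ)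
    (P : ∀ n, Measure (Ω n)) [∀ n, IsProbabilityMeasure (P n)] : Prop :=
  (∀ n, MemLp (X n) 2 (P n)) ∧
    TendstoInDistribution
      (fun n ω => (X n ω - ∫ ω', X n ω' ∂(P n)) / √(variance (X n) (P n)))
      atTop (id : ℝ → ℝ) P (gaussianReal 0 1)

end

/-! Length, hence `tStat`, is additive over the factors, so `T_n` is a sum of independent variables.
In rank two every element other than `1` and the longest one has a single right descent, so on
`I₂(m)` the statistic is `0` once, `4` once and `2` on the other `2m - 2` elements. Each factor thus
has mean `2`, variance `4 / m` and centred characteristic function `1 - (1 - cos 2u) / m`. Put `σ =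
∑ 1 / m i` and `u = t / √(4σ)`. The quantities `(1 - cos 2u) / m i` are bounded by `1 - cos 2u → 0`
and sum to `2σ sin² u → t² / 2`, so the product of the factors tends to `exp (-t² / 2)`
(`tendsto_prod_one_sub_cos`). Convergence of characteristic functions then gives the theorem. -/

namespace CoxeterSystem

/-! ### Lower bounds for the length -/

section Length

variable {B W : Type*} [Group W] {M : CoxeterMatrix B} (cs : CoxeterSystem M W)

/-- The length is the largest function vanishing at `1` that grows by at most `1` under right
multiplication by a simple reflection. -/
theorem le_length_of_mul_simple_le {f : W → ℕ} (h1 : f 1 = 0)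
    (h : ∀ w i, f (w * cs.simple i) ≤ f w + 1) (w : W) : f w ≤ cs.length w := by
  induction hn : cs.length w generalizing w with
  | zero => rw [cs.length_eq_zero_iff.1 hn, h1]
  | succ n ih =>
    have hw : w ≠ 1 := by rintro rfl; simp at hn
    obtain ⟨i, hi⟩ := cs.exists_rightDescent_of_ne_one hw
    rw [cs.isRightDescent_iff] at hi
    have := ih (w * cs.simple i) (by omega)
    have h' := h (w * cs.simple i) i
    rw [cs.simple_mul_simple_cancel_right] at h'
    omega

theorem length_eq_one_of_mem {s : W} (hs : s ∈ cs.simpleReflections) : cs.length s = 1 := by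
  obtain ⟨i, rfl⟩ := hs
  exact cs.length_simple i

theorem finite_simpleReflections [Finite B] : cs.simpleReflections.Finite := Set.finite_range _

theorem finite_descentSet [Finite B] (w : W) : (cs.descentSet w).Finite :=
  cs.finite_simpleReflections.subset fun _ h => h.1

end Length

/-! ### Additivity of length and descents over products -/

section Product

variable {ι : Type*} [DecidableEq ι] {B W : Type*} [Group W] {M : CoxeterMatrix B}
  {B' W' : ι → Type*} [∀ i, Group (W' i)] {M' : ∀ i, CoxeterMatrix (B' i)}
  {cs : CoxeterSystem M W} {cs' : ∀ i, CoxeterSystem (M' i) (W' i)} {φ : W ≃* (∀ i, W' i)}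

/-- Only coordinate `i` changes. The additive form avoids subtraction in `ℕ`. -/
theorem sum_length_mul_mulSingle_add [Fintype ι] (x : ∀ i, W' i) (i : ι) (s : W' i) :
    ∑ j, (cs' j).length ((x * Pi.mulSingle i s : ∀ i, W' i) j) + (cs' i).length (x i) =
      ∑ j, (cs' j).length (x j) + (cs' i).length (x i * s) := by
  rw [← Finset.add_sum_erase _ _ (Finset.mem_univ i), ← Finset.add_sum_erase _ _ (Finset.mem_univ i)]
  have : ∑ j ∈ Finset.univ.erase i, (cs' j).length ((x * Pi.mulSingle i s : ∀ i, W' i) j) =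
      ∑ j ∈ Finset.univ.erase i, (cs' j).length (x j) := by
    refine Finset.sum_congr rfl fun j hj => ?_
    rw [Pi.mul_apply, Pi.mulSingle_eq_of_ne (Finset.ne_of_mem_erase hj), mul_one]
  rw [this]
  simp only [Pi.mul_apply, Pi.mulSingle_eq_same]
  ring

theorem length_symm_mulSingle_le
    (hφ : φ '' cs.simpleReflections = ⋃ i, Pi.mulSingle i '' (cs' i).simpleReflections)
    (i : ι) (x : W' i) : cs.length (φ.symm (Pi.mulSingle i x)) ≤ (cs' i).length x := by
  refine (cs' i).le_length_of_mul_simple_le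
    (f := fun x => cs.length (φ.symm (Pi.mulSingle i x))) (by simp) (fun w b => ?_) x
  have hs : Pi.mulSingle i ((cs' i).simple b) ∈ φ '' cs.simpleReflections := by
    rw [hφ]
    exact Set.mem_iUnion.2 ⟨i, _, ⟨b, rfl⟩, rfl⟩
  obtain ⟨s, hs, hs'⟩ := hs
  simp only [Pi.mulSingle_mul, map_mul]
  rw [← hs', MulEquiv.symm_apply_apply]
  exact (cs.length_mul_le _ _).trans (by rw [cs.length_eq_one_of_mem hs])

/-- The length on a product of Coxeter systems is the sum of the lengths of the components. -/
theorem length_eq_sum_length [Fintype ι]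
    (hφ : φ '' cs.simpleReflections = ⋃ i, Pi.mulSingle i '' (cs' i).simpleReflections) (w : W) :
    cs.length w = ∑ i, (cs' i).length (φ w i) := by
  apply le_antisymm
  -- Upper bound: `w` is assembled one coordinate at a time.
  · have key : ∀ s : Finset ι, cs.length (φ.symm (fun i => if i ∈ s then φ w i else 1)) ≤
        ∑ i ∈ s, (cs' i).length (φ w i) := by
      intro s
      induction s using Finset.induction_on with
      | empty =>
        have : (fun i => if i ∈ (∅ : Finset ι) then φ w i else 1) = 1 := by ext; simp
        rw [this]
        simp
      | insert a s ha ih =>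
        have : (fun i => if i ∈ insert a s then φ w i else 1) =
            Pi.mulSingle a (φ w a) * (fun i => if i ∈ s then φ w i else 1) := by
          ext i
          rcases eq_or_ne i a with rfl | h
          · simp [ha]
          · simp [h]
        rw [this, map_mul, Finset.sum_insert ha]
        exact (cs.length_mul_le _ _).trans (add_le_add (length_symm_mulSingle_le hφ _ _) ih)
    simpa using key Finset.univ
  · refine cs.le_length_of_mul_simple_le (f := fun w => ∑ i, (cs' i).length (φ w i))
      (by simp) (fun w b => ?_) w
    have hs : φ (cs.simple b) ∈ φ '' cs.simpleReflections := ⟨_, ⟨b, rfl⟩, rfl⟩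
    rw [hφ] at hs
    obtain ⟨i, s, hs, hs'⟩ := Set.mem_iUnion.1 hs
    simp only [map_mul, ← hs']
    have h1 := sum_length_mul_mulSingle_add (cs' := cs') (φ w) i s
    have h2 := (cs' i).length_mul_le (φ w i) s
    rw [(cs' i).length_eq_one_of_mem hs] at h2
    omega

theorem image_descentSet [Fintype ι]
    (hφ : φ '' cs.simpleReflections = ⋃ i, Pi.mulSingle i '' (cs' i).simpleReflections) (w : W) :
    φ '' cs.descentSet w = ⋃ i, Pi.mulSingle i '' (cs' i).descentSet (φ w i) := by
  have key (i : ι) (s : W' i) (t : W) (h : Pi.mulSingle i s = φ t) :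
      cs.length (w * t) < cs.length w ↔
        (cs' i).length (φ w i * s) < (cs' i).length (φ w i) := by
    rw [length_eq_sum_length hφ, length_eq_sum_length hφ, map_mul, ← h]
    have h1 := sum_length_mul_mulSingle_add (cs' := cs') (φ w) i s
    omega
  ext x
  constructor
  · rintro ⟨t, ⟨ht, hlt⟩, rfl⟩
    have hs : φ t ∈ φ '' cs.simpleReflections := ⟨_, ht, rfl⟩
    rw [hφ] at hs
    obtain ⟨i, s, hs, hs'⟩ := Set.mem_iUnion.1 hs
    exact Set.mem_iUnion.2 ⟨i, s, ⟨hs, (key i s t hs').1 hlt⟩, hs'⟩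
  · intro hx
    obtain ⟨i, s, ⟨hs, hlt⟩, rfl⟩ := Set.mem_iUnion.1 hx
    have hm : Pi.mulSingle i s ∈ φ '' cs.simpleReflections := by
      rw [hφ]
      exact Set.mem_iUnion.2 ⟨i, _, hs, rfl⟩
    obtain ⟨t, ht, ht'⟩ := hm
    exact ⟨t, ⟨ht, (key i s t ht'.symm).2 hlt⟩, ht'⟩

/-- Descents are additive on products of Coxeter systems. -/
theorem des_eq_sum_des [Fintype ι] [∀ i, Finite (B' i)]
    (hφ : φ '' cs.simpleReflections = ⋃ i, Pi.mulSingle i '' (cs' i).simpleReflections) (w : W) :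
    cs.des w = ∑ i, (cs' i).des (φ w i) := by
  rw [des, ← Set.ncard_image_of_injective _ φ.injective, image_descentSet hφ,
    Set.ncard_iUnion_of_finite (fun i => ((cs' i).finite_descentSet _).image _),
    finsum_eq_sum_of_fintype]
  · exact Finset.sum_congr rfl fun i _ =>
      Set.ncard_image_of_injective _ (Pi.mulSingle_injective i)
  · intro i j hij
    rw [Function.onFun, Set.disjoint_left]
    rintro _ ⟨s, hs, rfl⟩ ⟨t, -, h⟩
    -- A common element would force `s = 1`, but simple reflections have length `1`.
    have h1 := congrFun h i
    rw [Pi.mulSingle_eq_same, Pi.mulSingle_eq_of_ne hij] at h1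
    have h2 := (cs' i).length_eq_one_of_mem hs.1
    rw [← h1] at h2
    simp at h2

/-- The statistic `t` is additive on products of Coxeter systems. -/
theorem tStat_eq_sum_tStat [Fintype ι] [∀ i, Finite (B' i)]
    (hφ : φ '' cs.simpleReflections = ⋃ i, Pi.mulSingle i '' (cs' i).simpleReflections) (w : W) :
    cs.tStat w = ∑ i, (cs' i).tStat (φ w i) := by
  simp only [tStat, des_eq_sum_des hφ, Finset.sum_add_distrib, map_inv, Pi.inv_apply]

end Product

/-! ### Descents in rank two -/

section RankTwo

variable {W : Type*} [Group W] {M : CoxeterMatrix (Fin 2)} (cs : CoxeterSystem M W)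

/-- Once a right descent is stripped off it is no longer a descent, so the next one must be the
other letter. Hence an element is determined by its length and one right descent. -/
theorem eq_wordProd_alternatingWord {w : W} {i j : Fin 2} (hij : i ≠ j)
    (hw : cs.IsRightDescent w j) :
    w = cs.wordProd (alternatingWord i j (cs.length w)) := by
  induction hn : cs.length w generalizing w i j with
  | zero => rw [cs.length_eq_zero_iff.1 hn]; simp [alternatingWord]
  | succ n ih =>
    have h1 := cs.isRightDescent_iff.1 hw
    rw [alternatingWord_succ, wordProd_concat]
    by_cases h : w * cs.simple j = 1
    · have : n = 0 := by rw [h] at h1; simp at h1; omega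
      subst this
      simpa [alternatingWord] using eq_inv_of_mul_eq_one_left h
    · obtain ⟨l, hl⟩ := cs.exists_rightDescent_of_ne_one h
      have hlj : l ≠ j := by
        rintro rfl
        exact cs.isRightDescent_iff_not_isRightDescent_mul.1 hw hl
      have hli : l = i := by omega
      subst hli
      rw [← ih hij.symm hl (by omega), cs.simple_mul_simple_cancel_right]

theorem length_le_of_forall_isRightDescent {w : W} (hw : ∀ j, cs.IsRightDescent w j) (u : W) :
    cs.length u ≤ cs.length w := by
  induction hn : cs.length u generalizing u with
  | zero => simp
  | succ n ih =>
    by_contra hlt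
    have hu : u ≠ 1 := by rintro rfl; simp at hn
    obtain ⟨j, hj⟩ := cs.exists_rightDescent_of_ne_one hu
    have h1 := cs.isRightDescent_iff.1 hj
    have h2 := ih (u * cs.simple j) (by omega)
    have h3 : cs.length (u * cs.simple j) = cs.length w := by omega
    have h4 : u * cs.simple j ≠ 1 := by
      intro h
      rw [h, cs.length_one] at h3
      have := cs.isRightDescent_iff.1 (hw 0)
      omega
    obtain ⟨l, hl⟩ := cs.exists_rightDescent_of_ne_one h4
    have hlj : j ≠ l := by
      rintro rfl
      exact cs.isRightDescent_iff_not_isRightDescent_mul.1 hj hl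
    -- Both elements have the same length and share the descent `l`. But then multiplying `w` by
    -- `cs.simple j` gives the longer `u`, although `j` is a descent of `w`.
    have h5 : u * cs.simple j = w := by
      rw [cs.eq_wordProd_alternatingWord hlj hl, h3, ← cs.eq_wordProd_alternatingWord hlj (hw l)]
    have h6 := cs.isRightDescent_iff.1 (hw j)
    rw [← h5, cs.simple_mul_simple_cancel_right] at h6
    omega

/-- A finite rank two Coxeter group has exactly one element with two descents. -/
theorem existsUnique_forall_isRightDescent [Finite W] :
    ∃! w : W, ∀ j, cs.IsRightDescent w j := by
  obtain ⟨w, hw⟩ := Finite.exists_max cs.length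
  refine ⟨w, fun j => lt_of_le_of_ne (hw _) (cs.length_mul_simple_ne w j), fun u hu => ?_⟩
  have hw' : ∀ j, cs.IsRightDescent w j :=
    fun j => lt_of_le_of_ne (hw _) (cs.length_mul_simple_ne w j)
  have h : cs.length u = cs.length w :=
    le_antisymm (hw u) (cs.length_le_of_forall_isRightDescent hu w)
  rw [cs.eq_wordProd_alternatingWord zero_ne_one (hu 1), h,
    ← cs.eq_wordProd_alternatingWord zero_ne_one (hw' 1)]

theorem forall_isRightDescent_inv {w : W} (hw : ∀ j, cs.IsRightDescent w j) :
    ∀ j, cs.IsRightDescent w⁻¹ j := fun j => by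
  refine lt_of_le_of_ne ?_ (cs.length_mul_simple_ne _ j)
  rw [cs.length_inv w]
  exact cs.length_le_of_forall_isRightDescent hw _

open Classical in
theorem des_eq_ite (hs : Function.Injective cs.simple) (w : W) :
    cs.des w = if w = 1 then 0 else if ∀ j, cs.IsRightDescent w j then 2 else 1 := by
  have h1 : cs.descentSet w = cs.simple '' {j | cs.IsRightDescent w j} := by
    ext x
    constructor
    · rintro ⟨⟨j, rfl⟩, h⟩
      exact ⟨j, h, rfl⟩
    · rintro ⟨j, h, rfl⟩
      exact ⟨⟨j, rfl⟩, h⟩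
  rw [des, h1, Set.ncard_image_of_injective _ hs]
  split_ifs with hw hw'
  · subst hw
    simp [cs.not_isRightDescent_one]
  · have : {j | cs.IsRightDescent w j} = Set.univ := by ext j; simp [hw' j]
    rw [this]
    simp [Set.ncard_univ]
  · obtain ⟨j, hj⟩ := cs.exists_rightDescent_of_ne_one hw
    rw [Set.ncard_eq_one]
    refine ⟨j, Set.eq_singleton_iff_unique_mem.2 ⟨hj, fun l hl => ?_⟩⟩
    by_contra hlj
    refine hw' fun a => ?_
    have : a = j ∨ a = l := by omega
    rcases this with rfl | rfl
    exacts [hj, hl]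

open Classical in
/-- The statistic `t` on a finite rank two Coxeter group is `0` at `1`, `4` at the longest element
and `2` elsewhere. -/
theorem exists_tStat_eq_ite [Finite W] (hs : Function.Injective cs.simple) :
    ∃ w₀ : W, w₀ ≠ 1 ∧ ∀ w, cs.tStat w = if w = 1 then 0 else if w = w₀ then 4 else 2 := by
  obtain ⟨w₀, h₀, huniq⟩ := cs.existsUnique_forall_isRightDescent
  refine ⟨w₀, ?_, fun w => ?_⟩
  · rintro rfl
    exact cs.not_isRightDescent_one 0 (h₀ 0)
  · have h1 (w : W) : (∀ j, cs.IsRightDescent w j) ↔ w = w₀ :=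
      ⟨huniq w, by rintro rfl; exact h₀⟩
    have h2 : w⁻¹ = w₀ ↔ w = w₀ := by
      rw [← h1, ← h1]
      exact ⟨fun h => by simpa using cs.forall_isRightDescent_inv h, cs.forall_isRightDescent_inv⟩
    simp only [tStat, cs.des_eq_ite hs, h1, h2, inv_eq_one]
    split_ifs <;> rfl

end RankTwo

end CoxeterSystem

/-! ### The group of type `I₂(m)` and its order `2m` -/

section Dihedral

open CoxeterSystem

variable {m : ℕ}

theorem isLiftable_dihedralGroup (hm : 2 ≤ m) :
    (dihedralMatrix m).IsLiftable
      (fun i : Fin 2 => (DihedralGroup.sr (i : ℕ) : DihedralGroup m)) := by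
  intro i j
  rw [dihedralMatrix_apply hm]
  split_ifs with h
  · subst h
    simp
  · simp only [DihedralGroup.sr_mul_sr]
    rw [DihedralGroup.r_pow]
    simp

/-- The homomorphism from the Coxeter group of type `I₂(m)` to the dihedral group. -/
noncomputable def toDihedralGroup (hm : 2 ≤ m) : (dihedralMatrix m).Group →* DihedralGroup m :=
  (dihedralSystem m).lift ⟨_, isLiftable_dihedralGroup hm⟩

theorem toDihedralGroup_simple (hm : 2 ≤ m) (i : Fin 2) :
    toDihedralGroup hm ((dihedralSystem m).simple i) = DihedralGroup.sr (i : ℕ) :=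
  (dihedralSystem m).lift_apply_simple _ i

/-- Needed because `des` counts elements of the group, not indices; the images in `DihedralGroup m`
separate the two generators. -/
theorem dihedralSystem_simple_injective (hm : 2 ≤ m) :
    Function.Injective (dihedralSystem m).simple := by
  intro i j h
  have h1 := congrArg (toDihedralGroup hm) h
  rw [toDihedralGroup_simple, toDihedralGroup_simple, DihedralGroup.sr.injEq,
    ZMod.natCast_eq_natCast_iff', Nat.mod_eq_of_lt (by omega), Nat.mod_eq_of_lt (by omega)] at h1
  exact Fin.ext h1

/-- The map from the dihedral group to the Coxeter group of type `I₂(m)` inverse to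
`toDihedralGroup`. -/
def ofDihedralGroup : DihedralGroup m → (dihedralMatrix m).Group
  | .r i => ((dihedralSystem m).simple 0 * (dihedralSystem m).simple 1) ^ i.val
  | .sr i => (dihedralSystem m).simple 0 *
      ((dihedralSystem m).simple 0 * (dihedralSystem m).simple 1) ^ i.val

theorem toDihedralGroup_ofDihedralGroup (hm : 2 ≤ m) (x : DihedralGroup m) :
    toDihedralGroup hm (ofDihedralGroup x) = x := by
  have : NeZero m := ⟨by omega⟩
  rcases x with i | i <;>
  simp [ofDihedralGroup, toDihedralGroup_simple, DihedralGroup.r_pow]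

/-- The elements `(ab)^z` and `a(ab)^z` are stable under right multiplication by `a` and `b`,
because conjugation by `a` inverts `ab`. -/
theorem ofDihedralGroup_surjective (hm : 2 ≤ m) :
    Function.Surjective (ofDihedralGroup (m := m)) := by
  have : NeZero m := ⟨by omega⟩
  set a := (dihedralSystem m).simple 0
  set b := (dihedralSystem m).simple 1
  have haa : a * a = 1 := (dihedralSystem m).simple_mul_simple_self 0
  have hpow : (a * b) ^ m = 1 := by
    have := (dihedralSystem m).simple_mul_simple_pow 0 1
    rwa [dihedralMatrix_apply hm, if_neg zero_ne_one] at this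
  have hz (z : ℤ) : (a * b) ^ ((z : ZMod m)).val = (a * b) ^ z := by
    rw [← zpow_natCast, ZMod.val_intCast, ← zpow_mod_orderOf _ (z % m), Int.emod_emod_of_dvd,
      zpow_mod_orderOf]
    exact Int.natCast_dvd_natCast.2 (orderOf_dvd_of_pow_eq_one hpow)
  have hr (z : ℤ) : ofDihedralGroup (.r (z : ZMod m)) = (a * b) ^ z := hz z
  have hsr (z : ℤ) : ofDihedralGroup (.sr (z : ZMod m)) = a * (a * b) ^ z := by
    rw [← hz z]; rfl
  have hinva : a⁻¹ = a := (dihedralSystem m).inv_simple 0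
  have hinvb : b⁻¹ = b := (dihedralSystem m).inv_simple 1
  have hconj (z : ℤ) : (a * b) ^ z * a = a * (a * b) ^ (-z) := by
    have : a * (a * b) * a⁻¹ = (a * b)⁻¹ := by
      rw [mul_inv_rev, hinva, hinvb, ← mul_assoc, haa, one_mul]
    rw [zpow_neg, ← inv_zpow, ← this, conj_zpow, hinva]
    simp only [← mul_assoc, haa, one_mul]
  have hmulb (x : (dihedralMatrix m).Group) : x * b = x * a * (a * b) := by
    rw [mul_assoc, ← mul_assoc a, haa, one_mul]
  intro w
  suffices h : ∃ z : ℤ, w = (a * b) ^ z ∨ w = a * (a * b) ^ z by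
    obtain ⟨z, rfl | rfl⟩ := h
    exacts [⟨_, hr z⟩, ⟨_, hsr z⟩]
  induction w using (dihedralSystem m).simple_induction_right with
  | one => exact ⟨0, by simp⟩
  | mul_simple_right w i ih =>
    have hi : (dihedralSystem m).simple i = a ∨ (dihedralSystem m).simple i = b := by
      fin_cases i
      exacts [Or.inl rfl, Or.inr rfl]
    obtain ⟨z, rfl | rfl⟩ := ih <;> rcases hi with h | h <;> rw [h]
    · exact ⟨-z, Or.inr (hconj z)⟩
    · refine ⟨-z + 1, Or.inr ?_⟩
      rw [hmulb, hconj, mul_assoc, zpow_add_one]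
    · refine ⟨-z, Or.inl ?_⟩
      rw [mul_assoc, hconj, ← mul_assoc, haa, one_mul]
    · refine ⟨-z + 1, Or.inl ?_⟩
      rw [hmulb, mul_assoc a, hconj, ← mul_assoc a a, haa, one_mul, zpow_add_one]

theorem ofDihedralGroup_bijective (hm : 2 ≤ m) :
    Function.Bijective (ofDihedralGroup (m := m)) :=
  ⟨Function.LeftInverse.injective (toDihedralGroup_ofDihedralGroup hm),
    ofDihedralGroup_surjective hm⟩

theorem finite_dihedralMatrix_group (hm : 2 ≤ m) : Finite (dihedralMatrix m).Group := by
  have : NeZero m := ⟨by omega⟩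
  exact Finite.of_surjective _ (ofDihedralGroup_surjective hm)

theorem card_dihedralMatrix_group (hm : 2 ≤ m) : Nat.card (dihedralMatrix m).Group = 2 * m := by
  rw [← Nat.card_eq_of_bijective _ (ofDihedralGroup_bijective hm), DihedralGroup.nat_card]

theorem sum_comp_tStat_dihedralSystem (hm : 2 ≤ m) [Fintype (dihedralMatrix m).Group]
    {R : Type*} [CommRing R] (g : ℕ → R) :
    ∑ w, g ((dihedralSystem m).tStat w) = g 0 + g 4 + (2 * m - 2) * g 2 := by
  classical
  have := finite_dihedralMatrix_group hm
  obtain ⟨w₀, hw₀, ht⟩ :=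
    (dihedralSystem m).exists_tStat_eq_ite (dihedralSystem_simple_injective hm)
  -- A constant plus corrections at the two exceptional elements.
  have h (w : (dihedralMatrix m).Group) : g ((dihedralSystem m).tStat w) =
      g 2 + (if w = 1 then g 0 - g 2 else 0) + (if w = w₀ then g 4 - g 2 else 0) := by
    rw [ht]
    by_cases h1 : w = 1
    · simp [h1, hw₀.symm]
    · by_cases h2 : w = w₀ <;> simp [h1, h2, hw₀]
  simp_rw [h, Finset.sum_add_distrib]
  simp only [Finset.sum_const, Finset.sum_ite_eq', Finset.mem_univ, if_true, Finset.card_univ,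
    ← Nat.card_eq_fintype_card, card_dihedralMatrix_group hm, nsmul_eq_mul]
  push_cast
  ring

end Dihedral

/-! ### Uniform measures on finite types -/

section Uniform

theorem uniformOn_univ_singleton {Ω : Type*} [Finite Ω] [MeasurableSpace Ω]
    [MeasurableSingletonClass Ω] (a : Ω) :
    uniformOn (Set.univ : Set Ω) {a} = (Nat.card Ω : ENNReal)⁻¹ := by
  have := Fintype.ofFinite Ω
  rw [uniformOn_univ, Measure.count_singleton, one_div, Nat.card_eq_fintype_card]

theorem integral_uniformOn_univ {Ω E : Type*} [Fintype Ω] [MeasurableSpace Ω]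
    [DiscreteMeasurableSpace Ω] [NormedAddCommGroup E] [NormedSpace ℝ E] [CompleteSpace E]
    (f : Ω → E) : ∫ x, f x ∂(uniformOn (Set.univ : Set Ω)) = (Nat.card Ω : ℝ)⁻¹ • ∑ x, f x := by
  cases isEmpty_or_nonempty Ω
  · simp [integral_of_isEmpty]
  · rw [integral_fintype (.of_finite), Finset.smul_sum]
    refine Finset.sum_congr rfl fun x _ => ?_
    rw [measureReal_def, uniformOn_univ_singleton]
    simp

/-- A bijection of a finite type with a product carries the uniform measure to the product of the
uniform measures. -/
theorem measurePreserving_uniformOn_pi {ι Ω : Type*} {Ω' : ι → Type*} [Fintype ι] [Finite Ω]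
    [∀ i, Finite (Ω' i)] [∀ i, Nonempty (Ω' i)] [MeasurableSpace Ω] [DiscreteMeasurableSpace Ω]
    [∀ i, MeasurableSpace (Ω' i)] [∀ i, DiscreteMeasurableSpace (Ω' i)] (e : Ω ≃ ∀ i, Ω' i) :
    MeasurePreserving e (uniformOn Set.univ) (Measure.pi fun i => uniformOn (Set.univ : Set (Ω' i)))
    where
  measurable := .of_discrete
  map_eq := by
    refine Measure.ext_of_singleton fun a => ?_
    have h : e ⁻¹' {a} = {e.symm a} := by
      ext x
      simp [Equiv.eq_symm_apply]
    rw [Measure.map_apply .of_discrete (measurableSet_singleton a), h, Measure.pi_singleton,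
      uniformOn_univ_singleton]
    simp_rw [uniformOn_univ_singleton]
    rw [Nat.card_congr e, Nat.card_pi, Nat.cast_prod, ENNReal.prod_inv_distrib]
    intro i _ j _ _
    exact Or.inr (ENNReal.natCast_ne_top _)

end Uniform

/-! ### Moments of `tStat` on one dihedral factor -/

section DihedralMoments

variable {m : ℕ}

theorem integral_comp_tStat_dihedralSystem (hm : 2 ≤ m) [MeasurableSpace (dihedralMatrix m).Group]
    [DiscreteMeasurableSpace (dihedralMatrix m).Group] {𝕜 : Type*} [RCLike 𝕜] (g : ℕ → 𝕜) :
    ∫ w, g ((dihedralSystem m).tStat w) ∂(uniformOn Set.univ) =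
      g 2 + (g 0 + g 4 - 2 * g 2) / (2 * m) := by
  have := finite_dihedralMatrix_group hm
  have := Fintype.ofFinite (dihedralMatrix m).Group
  have hm0 : (m : 𝕜) ≠ 0 := Nat.cast_ne_zero.2 (by omega)
  rw [integral_uniformOn_univ, sum_comp_tStat_dihedralSystem hm, card_dihedralMatrix_group hm,
    RCLike.real_smul_eq_coe_mul]
  push_cast
  field_simp
  ring

theorem integral_tStat_dihedralSystem (hm : 2 ≤ m) [MeasurableSpace (dihedralMatrix m).Group]
    [DiscreteMeasurableSpace (dihedralMatrix m).Group] :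
    ∫ w, ((dihedralSystem m).tStat w : ℝ) ∂(uniformOn Set.univ) = 2 := by
  rw [integral_comp_tStat_dihedralSystem hm (fun n => (n : ℝ))]
  norm_num

theorem variance_tStat_dihedralSystem (hm : 2 ≤ m) [MeasurableSpace (dihedralMatrix m).Group]
    [DiscreteMeasurableSpace (dihedralMatrix m).Group] :
    variance (fun w => ((dihedralSystem m).tStat w : ℝ)) (uniformOn Set.univ) = 4 / m := by
  have hm0 : (m : ℝ) ≠ 0 := Nat.cast_ne_zero.2 (by omega)
  rw [variance_eq_integral Measurable.of_discrete.aemeasurable, integral_tStat_dihedralSystem hm,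
    integral_comp_tStat_dihedralSystem hm (fun n => ((n : ℝ) - 2) ^ 2)]
  field_simp
  norm_num

theorem integral_exp_tStat_dihedralSystem (hm : 2 ≤ m)
    [MeasurableSpace (dihedralMatrix m).Group]
    [DiscreteMeasurableSpace (dihedralMatrix m).Group] (u : ℝ) :
    ∫ w, Complex.exp (u * (((dihedralSystem m).tStat w : ℝ) - 2) * Complex.I)
      ∂(uniformOn Set.univ) = ((1 - (1 - Real.cos (2 * u)) / m : ℝ) : ℂ) := by
  have hm0 : (m : ℂ) ≠ 0 := Nat.cast_ne_zero.2 (by omega)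
  rw [integral_comp_tStat_dihedralSystem hm
    (fun n => Complex.exp (u * (((n : ℕ) : ℝ) - 2) * Complex.I))]
  push_cast
  rw [Complex.cos]
  field_simp
  ring_nf
  simp

end DihedralMoments

/-! ### Moments of `tStat` on the product, by independence -/

section ProductMoments

variable {ι : Type*} [Fintype ι] [DecidableEq ι] {m : ι → ℕ} {B W : Type*} [Group W] [Finite W]
  [MeasurableSpace W] [DiscreteMeasurableSpace W] {M : CoxeterMatrix B} {cs : CoxeterSystem M W}

open CoxeterSystem

/-- The mean, the variance and the characteristic function of the statistic `t` on a product of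
dihedral groups. -/
theorem moments_tStat_of_isProduct_dihedralSystem (hm : ∀ i, 2 ≤ m i)
    (h : cs.IsProduct fun i => dihedralSystem (m i)) :
    ∫ w, (cs.tStat w : ℝ) ∂(uniformOn Set.univ) = 2 * Fintype.card ι ∧
    variance (fun w => (cs.tStat w : ℝ)) (uniformOn Set.univ) = 4 * ∑ i, 1 / (m i : ℝ) ∧
    ∀ u : ℝ, ∫ w, Complex.exp (u * ((cs.tStat w : ℝ) - 2 * Fintype.card ι) * Complex.I)
      ∂(uniformOn Set.univ) = ((∏ i, (1 - (1 - Real.cos (2 * u)) / m i) : ℝ) : ℂ) := by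
  obtain ⟨φ, hφ⟩ := h
  have (i : ι) := finite_dihedralMatrix_group (hm i)
  let _ (i : ι) : MeasurableSpace (dihedralMatrix (m i)).Group := ⊤
  have (i : ι) : DiscreteMeasurableSpace (dihedralMatrix (m i)).Group := ⟨fun _ => trivial⟩
  have hmp : MeasurePreserving φ _ _ := measurePreserving_uniformOn_pi φ.toEquiv
  have ht (w : W) : (cs.tStat w : ℝ) = ∑ i, ((dihedralSystem (m i)).tStat (φ w i) : ℝ) := by
    rw [tStat_eq_sum_tStat hφ, Nat.cast_sum]
  have hint {E : Type} [NormedAddCommGroup E] [NormedSpace ℝ E]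
      (f : (∀ i, (dihedralMatrix (m i)).Group) → E) :
      ∫ w, f (φ w) ∂(uniformOn Set.univ) = ∫ x, f x ∂(Measure.pi fun i => uniformOn Set.univ) := by
    rw [← hmp.map_eq, integral_map Measurable.of_discrete.aemeasurable
      (StronglyMeasurable.of_discrete).aestronglyMeasurable]
  refine ⟨?_, ?_, fun u => ?_⟩
  · simp_rw [ht]
    rw [hint (fun x => ∑ i, ((dihedralSystem (m i)).tStat (x i) : ℝ)),
      integral_finsetSum _ fun i _ => .of_finite]
    have (i : ι) : ∫ x : ∀ i, (dihedralMatrix (m i)).Group, ((dihedralSystem (m i)).tStat (x i) : ℝ)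
        ∂(Measure.pi fun i => uniformOn Set.univ) = 2 := by
      rw [integral_comp_eval (X := fun i => (dihedralMatrix (m i)).Group) (i := i)
        (f := fun y => ((dihedralSystem (m i)).tStat y : ℝ))
        (StronglyMeasurable.of_discrete).aestronglyMeasurable, integral_tStat_dihedralSystem (hm i)]
    simp_rw [this]
    simp [mul_comm]
  · have h1 : (fun w => (cs.tStat w : ℝ)) = (∑ i, fun x : ∀ i, (dihedralMatrix (m i)).Group =>
        ((dihedralSystem (m i)).tStat (x i) : ℝ)) ∘ φ := by
      ext w
      simp [ht]
    rw [h1, ← variance_map Measurable.of_discrete.aemeasurable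
      Measurable.of_discrete.aemeasurable, hmp.map_eq,
      variance_sum_pi (X := fun i y => ((dihedralSystem (m i)).tStat y : ℝ)) fun i => .of_discrete]
    simp_rw [variance_tStat_dihedralSystem (hm _), Finset.mul_sum]
    exact Finset.sum_congr rfl fun i _ => by ring
  · have h1 (w : W) : Complex.exp (u * ((cs.tStat w : ℝ) - 2 * Fintype.card ι) * Complex.I) =
        ∏ i, Complex.exp (u * (((dihedralSystem (m i)).tStat (φ w i) : ℝ) - 2) * Complex.I) := by
      rw [← Complex.exp_sum, ← Finset.sum_mul, ← Finset.mul_sum, Finset.sum_sub_distrib, ht]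
      simp [mul_comm]
    simp_rw [h1]
    rw [hint (fun x => ∏ i, Complex.exp
      (u * (((dihedralSystem (m i)).tStat (x i) : ℝ) - 2) * Complex.I)),
      integral_fintype_prod_eq_prod (fun i y => Complex.exp
        (u * (((dihedralSystem (m i)).tStat y : ℝ) - 2) * Complex.I))]
    simp_rw [integral_exp_tStat_dihedralSystem (hm _)]
    push_cast
    rfl

end ProductMoments

/-! ### Limit of the characteristic functions -/

section Limit

open Topology

/-- From `log y ≥ 1 - 1 / y` at `y = 1 - x`; it matches `1 - x ≤ exp (-x)` up to a factor tending to
`1` in the exponent. -/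
theorem exp_neg_div_one_sub_le {x c : ℝ} (hx : 0 ≤ x) (hxc : x ≤ c) (hc : c < 1) :
    Real.exp (-(x / (1 - c))) ≤ 1 - x := by
  have h1 : 0 < 1 - x := by linarith
  rw [← Real.le_log_iff_exp_le h1]
  refine le_trans ?_ (Real.one_sub_inv_le_log_of_pos h1)
  have h2 : 1 - (1 - x)⁻¹ = -(x / (1 - x)) := by
    field_simp
    ring
  rw [h2, neg_le_neg_iff]
  exact div_le_div_of_nonneg_left hx (by linarith) (by linarith)

/-- If nonnegative arrays `x n` have sums tending to `L` and are uniformly small, then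
`∏ (1 - x n i)` tends to `exp (-L)`. -/
theorem tendsto_prod_one_sub {ι : ℕ → Type*} [∀ n, Fintype (ι n)] {x : ∀ n, ι n → ℝ} {c : ℕ → ℝ}
    {L : ℝ} (hx : ∀ n i, 0 ≤ x n i) (hxc : ∀ n i, x n i ≤ c n) (hc : Tendsto c atTop (𝓝 0))
    (hL : Tendsto (fun n => ∑ i, x n i) atTop (𝓝 L)) :
    Tendsto (fun n => ∏ i, (1 - x n i)) atTop (𝓝 (Real.exp (-L))) := by
  have hlow : Tendsto (fun n => Real.exp (-((∑ i, x n i) / (1 - c n)))) atTop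
      (𝓝 (Real.exp (-L))) := by
    have h := hL.div (hc.const_sub 1) (by norm_num)
    rw [sub_zero, div_one] at h
    exact (Real.continuous_exp.tendsto _).comp h.neg
  have hup : Tendsto (fun n => Real.exp (-(∑ i, x n i))) atTop (𝓝 (Real.exp (-L))) :=
    (Real.continuous_exp.tendsto _).comp hL.neg
  have hc1 : ∀ᶠ n in atTop, c n < 1 := hc.eventually_lt_const one_pos
  refine tendsto_of_tendsto_of_tendsto_of_le_of_le' hlow hup ?_ ?_
  · filter_upwards [hc1] with n hn
    rw [Finset.sum_div, ← Finset.sum_neg_distrib, Real.exp_sum]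
    exact Finset.prod_le_prod (fun i _ => (Real.exp_pos _).le)
      fun i _ => exp_neg_div_one_sub_le (hx n i) (hxc n i) hn
  · filter_upwards [hc1] with n hn
    rw [← Finset.sum_neg_distrib, Real.exp_sum]
    exact Finset.prod_le_prod (fun i _ => by linarith [hxc n i])
      fun i _ => Real.one_sub_le_exp_neg _

theorem tendsto_prod_one_sub_cos {ι : ℕ → Type*} [∀ n, Fintype (ι n)] {m : ∀ n, ι n → ℕ}
    (hm : ∀ n i, 1 ≤ m n i)
    (hsum : Tendsto (fun n => ∑ i, 1 / (m n i : ℝ)) atTop atTop) (t : ℝ) :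
    Tendsto (fun n => ∏ i,
      (1 - (1 - Real.cos (2 * (t / √(4 * ∑ i, 1 / (m n i : ℝ))))) / m n i)) atTop
      (𝓝 (Real.exp (-(t ^ 2 / 2)))) := by
  have hu : Tendsto (fun n => t / √(4 * ∑ i, 1 / (m n i : ℝ))) atTop (𝓝 0) :=
    (Real.tendsto_sqrt_atTop.comp (hsum.const_mul_atTop (by norm_num))).const_div_atTop t
  refine tendsto_prod_one_sub
    (c := fun n => 1 - Real.cos (2 * (t / √(4 * ∑ i, 1 / (m n i : ℝ))))) ?_ ?_ ?_ ?_
  · exact fun n i => div_nonneg (sub_nonneg.2 (Real.cos_le_one _)) (by positivity)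
  · exact fun n i => div_le_self (sub_nonneg.2 (Real.cos_le_one _)) (by exact_mod_cast hm n i)
  · have h : Continuous fun u : ℝ => 1 - Real.cos (2 * u) := by fun_prop
    have h1 := (h.tendsto 0).comp hu
    rwa [mul_zero, Real.cos_zero, sub_self] at h1
  -- The sum equals `t² / 2 * sinc² u` once `σ > 0`; `Real.sinc` also covers `u = 0`, that is `t =
  -- 0`.
  · have h : Continuous fun u : ℝ => t ^ 2 / 2 * Real.sinc u ^ 2 :=
      continuous_const.mul (Real.continuous_sinc.pow 2)
    have h1 := (h.tendsto 0).comp hu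
    rw [Real.sinc_zero, one_pow, mul_one] at h1
    refine h1.congr' ?_
    filter_upwards [hsum.eventually_gt_atTop 0] with n hn
    simp_rw [div_eq_mul_one_div (1 - Real.cos _), ← Finset.mul_sum]
    simp only [Function.comp_apply]
    set σ := ∑ i, 1 / (m n i : ℝ)
    have hs : 0 < √(4 * σ) := Real.sqrt_pos.2 (by linarith)
    have hs2 : √(4 * σ) ^ 2 = 4 * σ := Real.sq_sqrt (by linarith)
    set s := √(4 * σ)
    have h2 : 1 - Real.cos (2 * (t / s)) = 2 * Real.sin (t / s) ^ 2 := by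
      rw [Real.cos_two_mul, Real.cos_sq']
      ring
    have h3 : Real.sin (t / s) = t / s * Real.sinc (t / s) := by
      rcases eq_or_ne (t / s) 0 with h0 | h0
      · simp [h0]
      · rw [Real.sinc_of_ne_zero h0, mul_div_cancel₀ _ h0]
    have h4 : σ = s ^ 2 / 4 := by linarith
    rw [h2, h3, h4]
    field_simp
    ring

end Limit

theorem lemma4p2
    (B W : ℕ → Type*) [∀ n, Group (W n)] [∀ n, Finite (W n)]
    [∀ n, MeasurableSpace (W n)] [∀ n, DiscreteMeasurableSpace (W n)]
    (M : ∀ n, CoxeterMatrix (B n)) (cs : ∀ n, CoxeterSystem (M n) (W n))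
    (k : ℕ → ℕ) (m : ∀ n, Fin (k n) → ℕ) (hm : ∀ n i, 3 ≤ m n i)
    (hW : ∀ n, (cs n).IsProduct (fun i => dihedralSystem (m n i)))
    (hsum : Tendsto (fun n => ∑ i, 1 / (m n i : ℝ)) atTop atTop) :
    SatisfiesCLT (fun n w => ((cs n).tStat w : ℝ))
      (fun n => uniformOn (Set.univ : Set (W n))) := by
  refine ⟨fun n => .of_discrete,
    { forall_aemeasurable := fun n => Measurable.of_discrete.aemeasurable
      tendsto := ?_ }⟩
  -- Lévy's continuity theorem.
  refine ProbabilityMeasure.tendsto_iff_tendsto_charFun.2 fun t => ?_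
  have hlim : charFun ((gaussianReal 0 1).map id) t = ((Real.exp (-(t ^ 2 / 2)) : ℝ) : ℂ) := by
    rw [Measure.map_id, charFun_gaussianReal]
    push_cast
    congr 1
    simp
  simp only [ProbabilityMeasure.coe_mk, hlim]
  refine ((Complex.continuous_ofReal.tendsto _).comp (tendsto_prod_one_sub_cos
    (fun n i => (by norm_num : 1 ≤ 3).trans (hm n i)) hsum t)).congr fun n => ?_
  obtain ⟨hmean, hvar, hchar⟩ := moments_tStat_of_isProduct_dihedralSystem
    (fun i => (by norm_num : 2 ≤ 3).trans (hm n i)) (hW n)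
  rw [Function.comp_apply, ← hchar, charFun_apply_real, integral_map
    Measurable.of_discrete.aemeasurable (by fun_prop), hmean, hvar]
  congr 1 with w
  congr 1
  push_cast
  ring
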